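/- Let $\Phi$ and $\Psi$ be independent homogeneous Poisson point processes in $\mathbb{R}^2$ of intensities $1$ and $\lambda>0$ (the nodes and the eavesdroppers), and add to $\Phi$ a node at the origin $o$. Let $0\le r<\infty$. In the enhanced secrecy graph $G'_{\lambda,r}$, two distinct nodes $x,y\in\Phi\cup\{o\}$ are joined by an (undirected) edge if and only if $\|x-y\|\le r$ and at least one of the two closed disks of radius $\|x-y\|$ centered at $x$ and at $y$ contains no point of $\Psi$. Let $N'$ be the degree of $o$ in $G'_{\lambda,r}$. Then $N'$ is almost surely finite and has finite expectation, and $$\mathbb{E}N'=\frac{2}{\lambda}\bigl(1-e^{-\lambda\pi r^2}\bigr)-\frac{1}{c\lambda}\bigl(1-e^{-c\lambda\pi r^2}\bigr),\qquad c=\frac43+\frac{\sqrt3}{2\pi}.$$ -/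

import Mathlib

open MeasureTheory ProbabilityTheory
open scoped NNReal ENNReal

/-- The number (possibly infinite) of points of the point set `φ` that fall in `A`. -/
noncomputable def pointCount {X : Type*} (φ A : Set X) : ℕ∞ := (φ ∩ A).encard

/-! ### Secrecy graphs of deterministic point sets -/

/-- The directed secrecy graph. Every edge of the underlying graph `G` on the node set `φ` is
replaced by two directed edges, and the directed edge from `x` to `y` is then removed whenever the
closed ball around the transmitter `x` with radius `dist x y` contains an eavesdropper. -/
def directedSecrecyGraph {X : Type*} [MetricSpace X] {φ : Set X} (G : SimpleGraph φ) (ψ : Set X) :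
    Digraph φ where
  Adj x y := G.Adj x y ∧ ¬ 0 < pointCount ψ (Metric.closedBall (x : X) (dist (x : X) (y : X)))

/-- The enhanced secrecy graph: `x` and `y` are joined if at least one of the two directed edges
between them belongs to the directed secrecy graph. -/
def enhancedSecrecyGraph {X : Type*} [MetricSpace X] {φ : Set X} (G : SimpleGraph φ) (ψ : Set X) :
    SimpleGraph φ where
  Adj x y := (directedSecrecyGraph G ψ).Adj x y ∨ (directedSecrecyGraph G ψ).Adj y x
  symm := ⟨fun _ _ h => h.symm⟩
  loopless := ⟨fun x h => h.elim (fun h => G.loopless.irrefl x h.1)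
    (fun h => G.loopless.irrefl x h.1)⟩

/-- Gilbert's disk graph on the node set `φ`: two distinct nodes are joined if their distance is
at most `r`. -/
def gilbertGraph {X : Type*} [MetricSpace X] (φ : Set X) (r : ℝ) : SimpleGraph φ where
  Adj x y := x ≠ y ∧ dist (x : X) (y : X) ≤ r
  symm := ⟨fun x y h => ⟨h.1.symm, by rw [dist_comm]; exact h.2⟩⟩
  loopless := ⟨fun _ h => h.1 rfl⟩

/-- The degree of a node, as an extended natural number. -/
noncomputable def nodeDegree {V : Type*} (G : SimpleGraph V) (x : V) : ℕ∞ :=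
  (G.neighborSet x).encard

/-! ### Poisson point processes -/

/-- The random point set `Φ` is a homogeneous Poisson point process of intensity `lam` in `ℝ^d`:
it is almost surely locally finite, the number of points in each Borel set `B` is a random
variable, which is Poisson distributed with mean `lam * volume B` when `B` has finite volume, and
the numbers of points in finitely many disjoint Borel sets are independent. -/
structure IsPoissonProcess {Ω : Type*} [MeasurableSpace Ω] {d : ℕ} (P : Measure Ω)
    (Φ : Ω → Set (EuclideanSpace ℝ (Fin d))) (lam : ℝ≥0) : Prop where
  locallyFinite : ∀ᵐ ω ∂P, ∀ K : Set (EuclideanSpace ℝ (Fin d)), IsCompact K → (Φ ω ∩ K).Finite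
  measurable_count : ∀ B : Set (EuclideanSpace ℝ (Fin d)), MeasurableSet B →
    Measurable fun ω => pointCount (Φ ω) B
  law_count : ∀ B : Set (EuclideanSpace ℝ (Fin d)), MeasurableSet B → volume B < ∞ →
    HasLaw (fun ω => pointCount (Φ ω) B)
      ((poissonMeasure (lam * (volume B).toNNReal)).map ((↑) : ℕ → ℕ∞)) P
  indep_count : ∀ (n : ℕ) (B : Fin n → Set (EuclideanSpace ℝ (Fin d))),
    (∀ i, MeasurableSet (B i)) → Pairwise (Function.onFun Disjoint B) →
    iIndepFun (fun i ω => pointCount (Φ ω) (B i)) P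

/-- The σ-algebra generated by a random point set, that is, by its numbers of points in all
Borel sets. -/
@[reducible] noncomputable def pointSigmaAlgebra {Ω X : Type*} [MeasurableSpace X] (Φ : Ω → Set X) : MeasurableSpace Ω :=
  ⨆ (B : Set X) (_ : MeasurableSet B),
    MeasurableSpace.comap (fun ω => pointCount (Φ ω) B) inferInstance

/-- Two random point sets are independent. -/
def IndepPointProcesses {Ω X : Type*} [MeasurableSpace Ω] [MeasurableSpace X] (P : Measure Ω)
    (Φ Ψ : Ω → Set X) : Prop :=
  Indep (pointSigmaAlgebra Φ) (pointSigmaAlgebra Ψ) P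

/-! ### The Poisson model -/

/-- The degree of the origin in the enhanced secrecy graph of Gilbert's disk graph of radius `r`,
where the node set is `φ` with a node added at the origin and the eavesdroppers are `ψ`. -/
noncomputable def enhancedDegree (φ ψ : Set (EuclideanSpace ℝ (Fin 2))) (r : ℝ) : ℕ∞ :=
  nodeDegree (enhancedSecrecyGraph (gilbertGraph (insert 0 φ) r) ψ) ⟨0, Set.mem_insert 0 φ⟩

/-- The constant `c`: `c * π * R ^ 2` is the area of the union of two disks of radius `R` whose
centres have distance `R`. -/
noncomputable def secrecyConst : ℝ := 4 / 3 + √3 / (2 * Real.pi)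

/-! ### The area of the union of two disks -/

/-! The degree of `o` counts the points of `Φ` in a random set that depends only on `Ψ` and lies in
the disk of radius `r` (`enhancedDegree_eq_pointCount`). Since `Φ` has intensity 1 and is
independent of `Ψ`, Campbell's formula (`IsPoissonProcess.lintegral_pointCount_of_indep`) turns the
expected degree into the integral over that disk of the probability that the disk around `0` or the
one around `x`, both of radius `‖x‖`, is free of eavesdroppers. By inclusion-exclusion this
probability is `2 exp(-λπ‖x‖²) - exp(-cλπ‖x‖²)`, because both disks are void exactly when their
union, of area `cπ‖x‖²`, is void (`volume_union_closedBall_norm`). Polar coordinates finish the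
computation, and a finite expectation forces almost sure finiteness.

The delicate point is measurability: Campbell's formula needs a condition jointly measurable in the
eavesdroppers and in `x`. `voidSet` supplies one from countably many balls, and `mem_voidSet_iff`
shows that it is the right one for locally finite `Ψ`. -/

theorem hasDerivAt_lens_primitive {R v : ℝ} (hR : 0 < R) (hv : v ^ 2 < R ^ 2) :
    HasDerivAt (fun v => v * √(R ^ 2 - v ^ 2) + R ^ 2 * Real.arcsin (v / R) - R * v)
      (2 * √(R ^ 2 - v ^ 2) - R) v := by
  have hpos : 0 < R ^ 2 - v ^ 2 := by linarith
  have hlt := abs_lt.1 (abs_lt_of_sq_lt_sq hv hR.le)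
  have h1 : v / R ≠ -1 := fun h => by
    rw [div_eq_iff hR.ne'] at h; linarith
  have h2 : v / R ≠ 1 := fun h => by
    rw [div_eq_iff hR.ne'] at h; linarith
  have hs : HasDerivAt (fun v => √(R ^ 2 - v ^ 2)) (-(2 * v) / (2 * √(R ^ 2 - v ^ 2))) v := by
    have := (((hasDerivAt_id v).pow 2).const_sub (R ^ 2)).sqrt hpos.ne'
    simpa using this
  have ha : HasDerivAt (fun v => Real.arcsin (v / R)) (1 / √(1 - (v / R) ^ 2) * (1 / R)) v :=
    (Real.hasDerivAt_arcsin h1 h2).comp (h := fun v => v / R) v ((hasDerivAt_id v).div_const R)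
  have hd := (((hasDerivAt_id v).mul hs).add (ha.const_mul (R ^ 2))).sub
    ((hasDerivAt_id v).const_mul R)
  refine hd.congr_deriv ?_
  have hq : √(1 - (v / R) ^ 2) = √(R ^ 2 - v ^ 2) / R := by
    rw [show 1 - (v / R) ^ 2 = (R ^ 2 - v ^ 2) / R ^ 2 by field_simp, Real.sqrt_div hpos.le,
      Real.sqrt_sq hR.le]
  have hsq : √(R ^ 2 - v ^ 2) ^ 2 = R ^ 2 - v ^ 2 := Real.sq_sqrt hpos.le
  have hsp : 0 < √(R ^ 2 - v ^ 2) := Real.sqrt_pos.2 hpos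
  rw [hq]
  simp only [id]
  field_simp
  linear_combination -hsq

theorem integral_lens_width {R : ℝ} (hR : 0 < R) :
    ∫ v in (-(√3 / 2 * R))..(√3 / 2 * R), (2 * √(R ^ 2 - v ^ 2) - R) =
      (2 * Real.pi / 3 - √3 / 2) * R ^ 2 := by
  have h3 : √3 ^ 2 = (3 : ℝ) := Real.sq_sqrt (by norm_num)
  have hle : -(√3 / 2 * R) ≤ √3 / 2 * R := by
    have : 0 ≤ √3 / 2 * R := by positivity
    linarith
  rw [intervalIntegral.integral_eq_sub_of_hasDerivAt
    (f := fun v => v * √(R ^ 2 - v ^ 2) + R ^ 2 * Real.arcsin (v / R) - R * v)]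
  · have harc : Real.arcsin (√3 / 2) = Real.pi / 3 := by
      rw [← Real.sin_pi_div_three, Real.arcsin_sin] <;> linarith [Real.pi_pos]
    have hs : √(R ^ 2 - (√3 / 2 * R) ^ 2) = R / 2 := by
      rw [show R ^ 2 - (√3 / 2 * R) ^ 2 = (R / 2) ^ 2 by linear_combination (-R ^ 2 / 4) * h3]
      exact Real.sqrt_sq (by positivity)
    simp only [neg_sq, hs, neg_div, mul_div_cancel_right₀ _ hR.ne', Real.arcsin_neg, harc]
    ring
  · intro v hv
    rw [Set.uIcc_of_le hle, Set.mem_Icc, ← abs_le] at hv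
    refine hasDerivAt_lens_primitive hR ?_
    have := sq_le_sq' (by linarith [(abs_le.1 hv).1]) (abs_le.1 hv).2
    nlinarith [pow_pos hR 2]
  · exact Continuous.intervalIntegrable (by fun_prop) _ _

theorem measurableSet_lens (R : ℝ) : MeasurableSet
    {p : ℝ × ℝ | p.1 ^ 2 + p.2 ^ 2 ≤ R ^ 2 ∧ p.1 ^ 2 + (p.2 - R) ^ 2 ≤ R ^ 2} := by
  have h1 : MeasurableSet {p : ℝ × ℝ | p.1 ^ 2 + p.2 ^ 2 ≤ R ^ 2} :=
    measurableSet_le (by fun_prop) (by fun_prop)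
  have h2 : MeasurableSet {p : ℝ × ℝ | p.1 ^ 2 + (p.2 - R) ^ 2 ≤ R ^ 2} :=
    measurableSet_le (by fun_prop) (by fun_prop)
  exact h1.inter h2

/-- Fubini with slices parallel to the line of centres: the slice at distance `|v|` from that line
is an interval of length `2√(R² - v²) - R`, which is nonnegative exactly for `|v| ≤ √3/2 * R`. -/
theorem volume_lens_prod {R : ℝ} (hR : 0 < R) :
    volume {p : ℝ × ℝ | p.1 ^ 2 + p.2 ^ 2 ≤ R ^ 2 ∧ p.1 ^ 2 + (p.2 - R) ^ 2 ≤ R ^ 2} =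
      ENNReal.ofReal ((2 * Real.pi / 3 - √3 / 2) * R ^ 2) := by
  have h3 : √3 ^ 2 = (3 : ℝ) := Real.sq_sqrt (by norm_num)
  have hle : -(√3 / 2 * R) ≤ √3 / 2 * R := by
    have : 0 ≤ √3 / 2 * R := by positivity
    linarith
  have hfib (v : ℝ) : volume (Prod.mk v ⁻¹'
      {p : ℝ × ℝ | p.1 ^ 2 + p.2 ^ 2 ≤ R ^ 2 ∧ p.1 ^ 2 + (p.2 - R) ^ 2 ≤ R ^ 2}) =
      ENNReal.ofReal (2 * √(R ^ 2 - v ^ 2) - R) := by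
    rcases le_or_gt (v ^ 2) (R ^ 2) with hv | hv
    · have : Prod.mk v ⁻¹'
          {p : ℝ × ℝ | p.1 ^ 2 + p.2 ^ 2 ≤ R ^ 2 ∧ p.1 ^ 2 + (p.2 - R) ^ 2 ≤ R ^ 2} =
          Set.Icc (R - √(R ^ 2 - v ^ 2)) √(R ^ 2 - v ^ 2) := by
        ext u
        have hsq : √(R ^ 2 - v ^ 2) ^ 2 = R ^ 2 - v ^ 2 := Real.sq_sqrt (by linarith)
        have hs0 := Real.sqrt_nonneg (R ^ 2 - v ^ 2)
        simp only [Set.mem_preimage, Set.mem_ofPred_eq, Set.mem_Icc]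
        constructor
        · rintro ⟨h1, h2⟩
          have a1 := abs_le_of_sq_le_sq' (show u ^ 2 ≤ √(R ^ 2 - v ^ 2) ^ 2 by linarith) hs0
          have a2 := abs_le_of_sq_le_sq' (show (u - R) ^ 2 ≤ √(R ^ 2 - v ^ 2) ^ 2 by linarith) hs0
          exact ⟨by linarith [a2.1], a1.2⟩
        · rintro ⟨h1, h2⟩
          have hsR : √(R ^ 2 - v ^ 2) ≤ R := Real.sqrt_le_iff.2 ⟨hR.le, by nlinarith [sq_nonneg v]⟩
          constructor
          · have := sq_le_sq' (show -√(R ^ 2 - v ^ 2) ≤ u by linarith) h2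
            linarith
          · have := sq_le_sq' (show -√(R ^ 2 - v ^ 2) ≤ u - R by linarith)
              (show u - R ≤ √(R ^ 2 - v ^ 2) by linarith)
            linarith
      rw [this, Real.volume_Icc]
      ring_nf
    -- Outside the disk the real square root is `0`, so the formula gives `-R`, truncated to the
    -- measure `0` of the empty slice.
    · rw [Real.sqrt_eq_zero_of_nonpos (by linarith), ENNReal.ofReal_of_nonpos (by linarith)]
      convert! measure_empty (μ := (volume : Measure ℝ))
      ext u
      simp only [Set.mem_preimage, Set.mem_ofPred_eq, Set.mem_empty_iff_false, iff_false, not_and]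
      intro h
      nlinarith [sq_nonneg u]
  rw [Measure.volume_eq_prod, Measure.prod_apply (measurableSet_lens R)]
  simp_rw [hfib]
  have hsupp : (fun v : ℝ => ENNReal.ofReal (2 * √(R ^ 2 - v ^ 2) - R)) =
      (Set.Icc (-(√3 / 2 * R)) (√3 / 2 * R)).indicator
        (fun v : ℝ => ENNReal.ofReal (2 * √(R ^ 2 - v ^ 2) - R)) := by
    ext v
    by_cases hv : v ∈ Set.Icc (-(√3 / 2 * R)) (√3 / 2 * R)
    · rw [Set.indicator_of_mem hv]
    · rw [Set.indicator_of_notMem hv]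
      refine ENNReal.ofReal_of_nonpos ?_
      have : √(R ^ 2 - v ^ 2) ≤ R / 2 := by
        refine Real.sqrt_le_iff.2 ⟨by positivity, ?_⟩
        by_contra! h
        refine hv (abs_le.1 (abs_le_of_sq_le_sq ?_ (by positivity)))
        rw [mul_pow, div_pow, h3]
        nlinarith
      linarith
  rw [hsupp, lintegral_indicator measurableSet_Icc, ← integral_lens_width hR,
    intervalIntegral.integral_of_le hle, ← integral_Icc_eq_integral_Ioc,
    ofReal_integral_eq_lintegral_ofReal]
  · exact (Continuous.continuousOn (by fun_prop)).integrableOn_compact isCompact_Icc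
  · refine (ae_restrict_iff' measurableSet_Icc).2 (ae_of_all _ fun v hv => ?_)
    have h1 := sq_le_sq' hv.1 hv.2
    rw [mul_pow, div_pow, h3] at h1
    have : R / 2 ≤ √(R ^ 2 - v ^ 2) := Real.le_sqrt_of_sq_le (by nlinarith)
    simp only [Pi.zero_apply]
    linarith

theorem volume_inter_closedBall_norm (x : EuclideanSpace ℝ (Fin 2)) :
    volume (Metric.closedBall 0 ‖x‖ ∩ Metric.closedBall x ‖x‖) =
      ENNReal.ofReal ((2 * Real.pi / 3 - √3 / 2) * ‖x‖ ^ 2) := by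
  rcases eq_or_ne x 0 with rfl | hx
  · simp
  have hR : 0 < ‖x‖ := norm_pos_iff.2 hx
  -- Rotate so that `x` lies on the second axis; orthonormal coordinates preserve area.
  obtain ⟨b, hb⟩ := Orthonormal.exists_orthonormalBasis_extension_of_card_eq (𝕜 := ℝ)
    (E := EuclideanSpace ℝ (Fin 2)) (ι := Fin 2) (by simp) (v := fun _ => (‖x‖⁻¹ : ℝ) • x)
    (s := {1}) (by
      rw [orthonormal_iff_ite]
      rintro ⟨i, rfl⟩ ⟨j, rfl⟩
      simp [Set.domRestrict, norm_smul, hR.ne'])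
  have hb1 : x = ‖x‖ • b 1 := by
    rw [hb 1 rfl, smul_smul, mul_inv_cancel₀ hR.ne', one_smul]
  have hx0 : b.repr x 0 = 0 := by
    conv_lhs => rw [hb1]
    simp [OrthonormalBasis.repr_self]
  have hx1 : b.repr x 1 = ‖x‖ := by
    conv_lhs => rw [hb1]
    simp [OrthonormalBasis.repr_self]
  have hmp := ((volume_preserving_finTwoArrow ℝ).comp
    (PiLp.volume_preserving_ofLp (Fin 2))).comp b.measurePreserving_repr
  rw [← volume_lens_prod hR, ← hmp.measure_preimage (measurableSet_lens ‖x‖).nullMeasurableSet]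
  congr 1
  ext y
  have h0 : ‖y‖ ^ 2 = b.repr y 0 ^ 2 + b.repr y 1 ^ 2 := by
    rw [← b.repr.norm_map y, EuclideanSpace.norm_sq_eq]
    simp
  have h1 : ‖y - x‖ ^ 2 = b.repr y 0 ^ 2 + (b.repr y 1 - ‖x‖) ^ 2 := by
    rw [← b.repr.norm_map (y - x), EuclideanSpace.norm_sq_eq]
    simp [hx0, hx1]
  simp only [Set.mem_inter_iff, mem_closedBall_iff_norm, sub_zero, Set.mem_preimage,
    Function.comp_apply, MeasurableEquiv.finTwoArrow_apply, Set.mem_ofPred_eq]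
  rw [← h0, ← h1, pow_le_pow_iff_left₀ (norm_nonneg _) (norm_nonneg _) two_ne_zero,
    pow_le_pow_iff_left₀ (norm_nonneg _) (norm_nonneg _) two_ne_zero]

theorem secrecyConst_pos : 0 < secrecyConst := by
  unfold secrecyConst
  positivity

theorem volume_closedBall_norm (x y : EuclideanSpace ℝ (Fin 2)) :
    volume (Metric.closedBall x ‖y‖) = ENNReal.ofReal (Real.pi * ‖y‖ ^ 2) := by
  rw [EuclideanSpace.volume_closedBall_fin_two, mul_comm, ENNReal.ofReal_mul Real.pi_pos.le,
    ENNReal.ofReal_pow (norm_nonneg _)]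

/-- Two disks minus the lens: `2π - (2π/3 - √3/2) = 4π/3 + √3/2 = cπ`. -/
theorem volume_union_closedBall_norm (x : EuclideanSpace ℝ (Fin 2)) :
    volume (Metric.closedBall 0 ‖x‖ ∪ Metric.closedBall x ‖x‖) =
      ENNReal.ofReal (secrecyConst * Real.pi * ‖x‖ ^ 2) := by
  have h := measure_union_add_inter (μ := volume) (Metric.closedBall 0 ‖x‖)
    (Metric.isClosed_closedBall (x := x) (ε := ‖x‖)).measurableSet
  have hnn : 0 ≤ 2 * Real.pi / 3 - √3 / 2 := by
    have : √3 ≤ 2 := Real.sqrt_le_iff.2 ⟨by norm_num, by norm_num⟩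
    linarith [Real.pi_gt_three]
  have hc := secrecyConst_pos
  rw [volume_inter_closedBall_norm, volume_closedBall_norm, volume_closedBall_norm] at h
  rw [ENNReal.eq_sub_of_add_eq ENNReal.ofReal_ne_top h, ← ENNReal.ofReal_add (by positivity)
    (by positivity), ← ENNReal.ofReal_sub _ (by positivity)]
  congr 1
  unfold secrecyConst
  field_simp
  ring

/-! ### A radial integral -/

theorem integral_mul_exp_neg_mul_sq {a r : ℝ} (ha : 0 < a) :
    ∫ y in (0 : ℝ)..r, y * Real.exp (-(a * y ^ 2)) =
      1 / (2 * a) * (1 - Real.exp (-(a * r ^ 2))) := by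
  rw [intervalIntegral.integral_eq_sub_of_hasDerivAt
    (f := fun y => -(1 / (2 * a)) * Real.exp (-(a * y ^ 2)))]
  · simp only [ne_eq, OfNat.ofNat_ne_zero, not_false_eq_true, zero_pow, mul_zero, neg_zero,
      Real.exp_zero]
    ring
  · intro y _
    have h := ((((hasDerivAt_id y).pow 2).const_mul a).fun_neg.exp).const_mul (-(1 / (2 * a)))
    refine h.congr_deriv ?_
    simp only [id]
    field_simp
    simp only [Nat.cast_ofNat, Pi.pow_apply, id, Nat.add_one_sub_one, pow_one]
    ring
  · exact Continuous.intervalIntegrable (by fun_prop) _ _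

theorem setIntegral_closedBall_exp_neg_mul_norm_sq {a r : ℝ} (ha : 0 < a) (hr : 0 ≤ r) :
    ∫ x in Metric.closedBall (0 : EuclideanSpace ℝ (Fin 2)) r, Real.exp (-(a * ‖x‖ ^ 2)) =
      Real.pi / a * (1 - Real.exp (-(a * r ^ 2))) := by
  have h1 : (Metric.closedBall (0 : EuclideanSpace ℝ (Fin 2)) r).indicator
      (fun x => Real.exp (-(a * ‖x‖ ^ 2))) =
      fun x => (Set.Iic r).indicator (fun y => Real.exp (-(a * y ^ 2))) ‖x‖ := by
    ext x
    by_cases hx : ‖x‖ ≤ r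
    · rw [Set.indicator_of_mem (by simpa using hx), Set.indicator_of_mem (by simpa using hx)]
    · rw [Set.indicator_of_notMem (by simpa using hx), Set.indicator_of_notMem (by simpa using hx)]
  have h2 : (fun y : ℝ => y ^ (Module.finrank ℝ (EuclideanSpace ℝ (Fin 2)) - 1) •
      (Set.Iic r).indicator (fun y => Real.exp (-(a * y ^ 2))) y) =
      (Set.Iic r).indicator (fun y => y * Real.exp (-(a * y ^ 2))) := by
    ext y
    by_cases hy : y ∈ Set.Iic r <;> simp [hy]
  have h3 : volume.real (Metric.ball (0 : EuclideanSpace ℝ (Fin 2)) 1) = Real.pi := by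
    simp [measureReal_def, EuclideanSpace.volume_ball_fin_two, Real.pi_pos.le]
  rw [← integral_indicator Metric.isClosed_closedBall.measurableSet, h1,
    integral_fun_norm_addHaar, h2, h3, setIntegral_indicator measurableSet_Iic, Set.Ioi_inter_Iic,
    ← intervalIntegral.integral_of_le hr, integral_mul_exp_neg_mul_sq ha]
  simp
  field_simp

/-! ### Counting points of a Poisson process -/

/-- The weights satisfy `(n + 1) p(n + 1) = m p(n)`, so shifting the index leaves `m` times the
total mass. -/
theorem lintegral_natCast_poissonMeasure (m : ℝ≥0) :
    ∫⁻ n : ℕ, (n : ℝ≥0∞) ∂poissonMeasure m = m := by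
  have hterm (n : ℕ) : ((n + 1 : ℕ) : ℝ≥0∞) * poissonMeasure m {n + 1} =
      m * poissonMeasure m {n} := by
    rw [poissonMeasure_singleton, poissonMeasure_singleton, ← ENNReal.ofReal_natCast,
      ← ENNReal.ofReal_coe_nnreal, ← ENNReal.ofReal_mul (by positivity),
      ← ENNReal.ofReal_mul (by positivity), Nat.factorial_succ]
    congr 1
    push_cast
    field_simp
    ring
  have hone : ∑' n, poissonMeasure m {n} = 1 := by
    have := lintegral_countable' (μ := poissonMeasure m) (fun _ => 1)
    simpa using this.symm
  rw [lintegral_countable', tsum_eq_zero_add' ENNReal.summable]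
  simp only [hterm, ENNReal.tsum_mul_left, hone]
  simp

section Count

variable {Ω : Type*} [MeasurableSpace Ω] {d : ℕ} {P : Measure Ω}
  {Φ : Ω → Set (EuclideanSpace ℝ (Fin d))} {lam : ℝ≥0}

theorem IsPoissonProcess.lintegral_pointCount (hΦ : IsPoissonProcess P Φ lam)
    {B : Set (EuclideanSpace ℝ (Fin d))} (hB : MeasurableSet B) (hBv : volume B < ∞) :
    ∫⁻ ω, (pointCount (Φ ω) B : ℝ≥0∞) ∂P = lam * volume B := by
  rw [(hΦ.law_count B hB hBv).lintegral_comp (f := fun n : ℕ∞ => (n : ℝ≥0∞)) (by fun_prop),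
    lintegral_map (by fun_prop) (by fun_prop)]
  simp only [ENat.toENNReal_coe, lintegral_natCast_poissonMeasure, ENNReal.coe_mul,
    ENNReal.coe_toNNReal hBv.ne]

theorem IsPoissonProcess.measure_pointCount_eq_zero (hΦ : IsPoissonProcess P Φ lam)
    {B : Set (EuclideanSpace ℝ (Fin d))} (hB : MeasurableSet B) (hBv : volume B < ∞) :
    P {ω | pointCount (Φ ω) B = 0} = ENNReal.ofReal (Real.exp (-(lam * (volume B).toReal))) := by
  have hlaw := hΦ.law_count B hB hBv
  have h : {ω | pointCount (Φ ω) B = 0} = (fun ω => pointCount (Φ ω) B) ⁻¹' {0} := rfl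
  have h0 : ((↑) : ℕ → ℕ∞) ⁻¹' {0} = {0} := by
    ext n
    simp
  rw [h, ← Measure.map_apply_of_aemeasurable hlaw.aemeasurable .of_discrete, hlaw.map_eq,
    Measure.map_apply (by fun_prop) .of_discrete, h0, poissonMeasure_singleton]
  simp [ENNReal.toReal]

/-- The point counts inside a set `K` in which there are almost surely finitely many points form an
s-finite kernel. -/
theorem exists_countKernel {X : Type*} [MeasurableSpace X] [MeasurableSingletonClass X]
    {Φ : Ω → Set X} {K : Set X} (hK : MeasurableSet K)
    (hΦ : ∀ B, MeasurableSet B → Measurable fun ω => pointCount (Φ ω) B)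
    (hfin : ∀ᵐ ω ∂P, (Φ ω ∩ K).Finite) :
    ∃ κ : Kernel Ω X, IsSFiniteKernel κ ∧
      ∀ᵐ ω ∂P, ∀ B, MeasurableSet B → κ ω B = (pointCount (Φ ω) (B ∩ K) : ℝ≥0∞) := by
  classical
  have hcount {ω : Ω} (hω : pointCount (Φ ω) K ≠ ⊤) {B : Set X} (hB : MeasurableSet B) :
      Measure.count.restrict (Φ ω ∩ K) B = (pointCount (Φ ω) (B ∩ K) : ℝ≥0∞) := by
    have hf : (Φ ω ∩ K).Finite := Set.encard_ne_top_iff.1 hω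
    rw [Measure.restrict_apply hB, Measure.count_apply (hB.inter hf.measurableSet)]
    unfold pointCount
    congr 2
    ext x
    simp only [Set.mem_inter_iff]
    tauto
  have hE (n : ℕ∞) : MeasurableSet {ω | pointCount (Φ ω) K = n} :=
    hΦ K hK (MeasurableSet.of_discrete (s := {n}))
  -- Splitting by the number of points in `K` makes each piece a finite kernel, and the sum vanishes
  -- on the null event of infinitely many points.
  let κn (n : ℕ) : Kernel Ω X :=
    { toFun := fun ω => if pointCount (Φ ω) K = n then Measure.count.restrict (Φ ω ∩ K) else 0
      measurable' := by
        refine Measure.measurable_of_measurable_coe _ fun B hB => ?_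
        have : (fun ω => (if pointCount (Φ ω) K = n then Measure.count.restrict (Φ ω ∩ K)
            else 0 : Measure X) B) =
            {ω | pointCount (Φ ω) K = n}.indicator
              fun ω => (pointCount (Φ ω) (B ∩ K) : ℝ≥0∞) := by
          ext ω
          by_cases h : pointCount (Φ ω) K = n
          · rw [Set.indicator_of_mem (by exact h), if_pos h, hcount (by simp [h]) hB]
          · rw [Set.indicator_of_notMem (by exact h), if_neg h]
            simp
        rw [this]
        exact ((measurable_of_countable _).comp (hΦ _ (hB.inter hK))).indicator (hE n) }
  have hκn (n : ℕ) (ω : Ω) : κn n ω =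
      if pointCount (Φ ω) K = n then Measure.count.restrict (Φ ω ∩ K) else 0 := rfl
  refine ⟨Kernel.sum κn, ⟨κn, fun n => ⟨n, by simp, fun ω => ?_⟩, rfl⟩, ?_⟩
  · rw [hκn]
    split_ifs with h
    · rw [hcount (by simp [h]) MeasurableSet.univ, Set.univ_inter, h]
      simp
    · simp
  · filter_upwards [hfin] with ω hω B hB
    obtain ⟨n, hn⟩ : ∃ n : ℕ, pointCount (Φ ω) K = n :=
      ⟨_, (ENat.natCast_toNat (Set.encard_ne_top_iff.2 hω)).symm⟩
    rw [Kernel.sum_apply' _ _ hB, tsum_eq_single n, hκn, if_pos hn, hcount (by simp [hn]) hB]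
    intro k hk
    rw [hκn, if_neg]
    · simp
    · rw [hn]
      exact_mod_cast hk.symm

variable [IsProbabilityMeasure P] {S : Type*} [MeasurableSpace S] {Y : Ω → S}
  {A : Set (S × EuclideanSpace ℝ (Fin d))} {K : Set (EuclideanSpace ℝ (Fin d))}

/-- Campbell's formula for the number of points of a Poisson process in a compact set that satisfy
a condition which depends on an independent random element. -/
theorem IsPoissonProcess.lintegral_pointCount_of_indep (hΦ : IsPoissonProcess P Φ lam)
    (hY : Measurable Y)
    (hind : Indep (pointSigmaAlgebra Φ) (MeasurableSpace.comap Y inferInstance) P)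
    (hA : MeasurableSet A) (hK : IsCompact K) :
    AEMeasurable (fun ω => pointCount (Φ ω) ({x | (Y ω, x) ∈ A} ∩ K)) P ∧
    ∫⁻ ω, (pointCount (Φ ω) ({x | (Y ω, x) ∈ A} ∩ K) : ℝ≥0∞) ∂P =
      lam * ∫⁻ x in K, P {ω | (Y ω, x) ∈ A} := by
  obtain ⟨κ, hκ, hκΦ⟩ := exists_countKernel hK.measurableSet hΦ.measurable_count
    (hΦ.locallyFinite.mono fun ω h => h K hK)
  have hle : pointSigmaAlgebra Φ ≤ (inferInstance : MeasurableSpace Ω) :=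
    iSup₂_le fun B hB => (hΦ.measurable_count B hB).comap_le
  have hsec (ω : Ω) : MeasurableSet {x | (Y ω, x) ∈ A} := measurable_prodMk_left hA
  have hA' : MeasurableSet (Prod.map Y id ⁻¹' A : Set (Ω × EuclideanSpace ℝ (Fin d))) :=
    (hY.prodMap measurable_id) hA
  have hmeas : Measurable fun ω => κ ω {x | (Y ω, x) ∈ A} :=
    Kernel.measurable_kernel_prodMk_left hA'
  have hfin : IsFiniteMeasure (volume.restrict K) := ⟨by simpa using hK.measure_lt_top⟩
  -- The core of Campbell's formula: both measures agree on rectangles, where independence factors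
  -- the expectation into `P (Y ∈ G)` and the mean count.
  have hprod : (P.map Y).prod ((lam : ℝ≥0∞) • volume.restrict K) =
      (P ⊗ₘ κ).map (Prod.map Y id) := by
    have : IsProbabilityMeasure (P.map Y) := Measure.isProbabilityMeasure_map hY.aemeasurable
    have : IsFiniteMeasure ((lam : ℝ≥0∞) • volume.restrict K) :=
      Measure.smul_finite _ ENNReal.coe_ne_top
    refine Measure.prod_eq fun G B hG hB => ?_
    have hBK := hB.inter hK.measurableSet
    rw [Measure.map_apply (hY.prodMap measurable_id) (hG.prod hB),
      show Prod.map Y id ⁻¹' (G ×ˢ B) = (Y ⁻¹' G) ×ˢ B from rfl,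
      Measure.compProd_apply_prod (hY hG) hB, Measure.map_apply hY hG,
      Measure.smul_apply, smul_eq_mul, Measure.restrict_apply hB,
      ← hΦ.lintegral_pointCount hBK
        ((measure_mono Set.inter_subset_right).trans_lt hK.measure_lt_top),
      ← lintegral_indicator (hY hG)]
    have hmul := lintegral_mul_eq_lintegral_mul_lintegral_of_independent_measurableSpace
      hY.comap_le hle hind.symm
      (f := (Y ⁻¹' G).indicator 1) (g := fun ω => (pointCount (Φ ω) (B ∩ K) : ℝ≥0∞))
      ((measurable_one.indicator hG).comp (comap_measurable Y))
      ((measurable_of_countable _).comp (Measurable.of_comap_le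
        (le_iSup₂_of_le (B ∩ K) hBK le_rfl)))
    rw [lintegral_indicator_one (hY hG)] at hmul
    rw [← hmul]
    refine lintegral_congr_ae ?_
    filter_upwards [hκΦ] with ω hω
    by_cases h : ω ∈ Y ⁻¹' G
    · simp [Set.indicator_of_mem h, hω B hB]
    · simp [Set.indicator_of_notMem h]
  constructor
  -- The kernel gives measurability in `ℝ≥0∞` only; a measurable left inverse of the embedding
  -- brings it back to `ℕ∞`.
  · have hemb : MeasurableEmbedding ((↑) : ℕ∞ → ℝ≥0∞) :=
      ⟨ENat.toENNReal_strictMono.injective, by fun_prop,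
        fun s _ => (s.to_countable.image _).measurableSet⟩
    obtain ⟨g, hg, hgid⟩ := hemb.exists_measurable_extend measurable_id fun _ => ⟨0⟩
    refine ⟨fun ω => g (κ ω {x | (Y ω, x) ∈ A}), hg.comp hmeas, ?_⟩
    filter_upwards [hκΦ] with ω hω
    rw [hω _ (hsec ω)]
    exact (congrFun hgid _).symm
  · calc
      _ = ∫⁻ ω, κ ω {x | (Y ω, x) ∈ A} ∂P :=
        lintegral_congr_ae (hκΦ.mono fun ω hω => (hω _ (hsec ω)).symm)
      _ = (P ⊗ₘ κ).map (Prod.map Y id) A := by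
        rw [Measure.map_apply (hY.prodMap measurable_id) hA, Measure.compProd_apply hA']
        rfl
      _ = _ := by
        rw [← hprod, Measure.prod_apply_symm hA, lintegral_smul_measure]
        congr 1
        refine lintegral_congr fun x => ?_
        rw [Measure.map_apply hY (measurable_prodMk_right hA)]
        rfl

end Count

/-! ### Void closed balls -/

theorem pointCount_eq_zero_iff {X : Type*} {ψ B : Set X} :
    pointCount ψ B = 0 ↔ Disjoint ψ B := by
  rw [pointCount, Set.encard_eq_zero, Set.disjoint_iff_inter_eq_empty]

section Void

variable {X : Type*} [PseudoMetricSpace X]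

/-- The numbers of points of `ψ` in all closed balls. -/
noncomputable def ballCounts (ψ : Set X) (p : X × ℝ) : ℕ∞ :=
  pointCount ψ (Metric.closedBall p.1 p.2)

theorem comap_ballCounts_le {Ω : Type*} [MeasurableSpace X] [OpensMeasurableSpace X]
    (Ψ : Ω → Set X) :
    MeasurableSpace.comap (fun ω => ballCounts (Ψ ω)) MeasurableSpace.pi ≤ pointSigmaAlgebra Ψ := by
  rw [MeasurableSpace.pi, MeasurableSpace.comap_iSup]
  refine iSup_le fun p => ?_
  rw [MeasurableSpace.comap_comp]
  exact le_iSup₂_of_le (Metric.closedBall p.1 p.2) Metric.isClosed_closedBall.measurableSet le_rfl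

/-- The pairs of a family of ball counts and a point `x` such that some closed ball from a countable
family contains no point and contains the closed ball with centre `c x` and radius `ρ x` in a way
that can be read off from the triangle inequality. -/
def voidSet [TopologicalSpace.SeparableSpace X] [Nonempty X] (c : X → X) (ρ : X → ℝ) :
    Set ((X × ℝ → ℕ∞) × X) :=
  ⋃ (n : ℕ) (s : ℚ), {y | y (TopologicalSpace.denseSeq X n, (s : ℝ)) = 0} ×ˢ
    {x | dist (c x) (TopologicalSpace.denseSeq X n) + ρ x ≤ s}

theorem measurableSet_voidSet [TopologicalSpace.SeparableSpace X] [Nonempty X] [MeasurableSpace X]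
    [OpensMeasurableSpace X] {c : X → X} {ρ : X → ℝ} (hc : Continuous c) (hρ : Continuous ρ) :
    MeasurableSet (voidSet c ρ) := by
  refine MeasurableSet.iUnion fun n => MeasurableSet.iUnion fun s => MeasurableSet.prod ?_ ?_
  · exact measurable_pi_apply (TopologicalSpace.denseSeq X n, (s : ℝ))
      (MeasurableSet.of_discrete (s := {0}))
  · exact (isClosed_le (by fun_prop) continuous_const).measurableSet

/-- Local finiteness leaves room around a void closed ball: a slightly larger one is still void, and
a ball with centre in the dense sequence and rational radius fits between the two. -/
theorem mem_voidSet_iff [TopologicalSpace.SeparableSpace X] [Nonempty X] [ProperSpace X]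
    {ψ : Set X} (hψ : ∀ K, IsCompact K → (ψ ∩ K).Finite) {c : X → X} {ρ : X → ℝ} {x : X} :
    (ballCounts ψ, x) ∈ voidSet c ρ ↔ pointCount ψ (Metric.closedBall (c x) (ρ x)) = 0 := by
  simp only [voidSet, Set.mem_iUnion, Set.mem_prod, Set.mem_ofPred_eq, ballCounts]
  constructor
  · rintro ⟨n, s, h0, hs⟩
    rw [pointCount_eq_zero_iff] at h0 ⊢
    exact h0.mono_right (Metric.closedBall_subset_closedBall' (by linarith))
  · intro h
    rw [pointCount_eq_zero_iff] at h
    obtain ⟨ε, hε, hdisj⟩ : ∃ ε > 0, Disjoint ψ (Metric.closedBall (c x) (ρ x + ε)) := by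
      have hfin := hψ _ (isCompact_closedBall (c x) (ρ x + 1))
      obtain ⟨δ, hδ, hδψ⟩ : ∃ δ > 0, ∀ z ∈ ψ ∩ Metric.closedBall (c x) (ρ x + 1),
          δ ≤ dist z (c x) - ρ x := by
        rcases (ψ ∩ Metric.closedBall (c x) (ρ x + 1)).eq_empty_or_nonempty with he | hne
        · exact ⟨1, one_pos, by simp [he]⟩
        · obtain ⟨w, hw, hmin⟩ := Set.exists_min_image _ (fun z => dist z (c x) - ρ x) hfin hne
          refine ⟨_, sub_pos.2 ?_, hmin⟩
          by_contra! hle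
          exact h.notMem_of_mem_left hw.1 (Metric.mem_closedBall.2 hle)
      -- The cap `1` keeps the enlarged ball inside the region where the gap `δ` is valid.
      refine ⟨min (δ / 2) 1, by positivity, Set.disjoint_left.2 fun z hz hzB => ?_⟩
      rw [Metric.mem_closedBall] at hzB
      have h1 := min_le_left (δ / 2) 1
      have h2 := min_le_right (δ / 2) 1
      have := hδψ z ⟨hz, Metric.mem_closedBall.2 (by linarith)⟩
      linarith
    obtain ⟨n, hn⟩ := (TopologicalSpace.denseRange_denseSeq X).exists_dist_lt (c x)
      (show 0 < ε / 4 by positivity)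
    -- With centres less than `ε / 4` apart, the lower bound on `s` covers the original ball and the
    -- upper bound stays inside the enlarged one.
    obtain ⟨s, hs1, hs2⟩ := exists_rat_btwn (show ρ x + ε / 4 < ρ x + ε / 2 by linarith)
    refine ⟨n, s, ?_, by linarith⟩
    rw [pointCount_eq_zero_iff]
    refine hdisj.mono_right (Metric.closedBall_subset_closedBall' ?_)
    rw [dist_comm]
    linarith

end Void

/-! ### The degree of the origin -/

theorem enhancedDegree_eq_pointCount (φ ψ : Set (EuclideanSpace ℝ (Fin 2))) (r : ℝ) :
    enhancedDegree φ ψ r =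
      pointCount φ ({x | x ≠ 0 ∧ (pointCount ψ (Metric.closedBall 0 ‖x‖) = 0 ∨
        pointCount ψ (Metric.closedBall x ‖x‖) = 0)} ∩ Metric.closedBall 0 r) := by
  rw [enhancedDegree, nodeDegree, pointCount, ← Subtype.val_injective.encard_image]
  congr 1
  ext x
  simp only [Set.mem_image, SimpleGraph.mem_neighborSet, enhancedSecrecyGraph, directedSecrecyGraph,
    gilbertGraph, Subtype.exists, Set.mem_inter_iff, Set.mem_ofPred_eq, mem_closedBall_zero_iff,
    not_lt, nonpos_iff_eq_zero, ne_eq, Subtype.mk.injEq, dist_zero_left, dist_zero_right]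
  constructor
  · rintro ⟨a, ha, h, rfl⟩
    have h0 : a ≠ 0 := h.elim (fun h => Ne.symm h.1.1) (fun h => h.1.1)
    exact ⟨ha.resolve_left h0, ⟨h0, h.imp And.right And.right⟩, h.elim (·.1.2) (·.1.2)⟩
  · rintro ⟨hx, ⟨h0, h⟩, hr⟩
    exact ⟨x, Or.inr hx, h.imp (⟨⟨Ne.symm h0, hr⟩, ·⟩) (⟨⟨h0, hr⟩, ·⟩), rfl⟩

section Probability

variable {Ω : Type*} [MeasurableSpace Ω] {P : Measure Ω}
  {Ψ : Ω → Set (EuclideanSpace ℝ (Fin 2))} {lam : ℝ≥0}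

/-- The probability that one of two disks with radius equal to the distance of their centres
contains no point of a Poisson process. -/
theorem IsPoissonProcess.measure_void_or_void (hΨ : IsPoissonProcess P Ψ lam)
    (x : EuclideanSpace ℝ (Fin 2)) :
    P {ω | pointCount (Ψ ω) (Metric.closedBall 0 ‖x‖) = 0 ∨
        pointCount (Ψ ω) (Metric.closedBall x ‖x‖) = 0} =
      ENNReal.ofReal (2 * Real.exp (-(lam * Real.pi * ‖x‖ ^ 2)) -
        Real.exp (-(secrecyConst * lam * Real.pi * ‖x‖ ^ 2))) := by
  have hB (y : EuclideanSpace ℝ (Fin 2)) : MeasurableSet (Metric.closedBall y ‖x‖) :=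
    Metric.isClosed_closedBall.measurableSet
  have hball (y : EuclideanSpace ℝ (Fin 2)) :
      P {ω | pointCount (Ψ ω) (Metric.closedBall y ‖x‖) = 0} =
        ENNReal.ofReal (Real.exp (-(lam * Real.pi * ‖x‖ ^ 2))) := by
    rw [hΨ.measure_pointCount_eq_zero (hB y) (isCompact_closedBall _ _).measure_lt_top,
      volume_closedBall_norm, ENNReal.toReal_ofReal (by positivity), mul_assoc]
  have hc := secrecyConst_pos
  have hunion : P ({ω | pointCount (Ψ ω) (Metric.closedBall 0 ‖x‖) = 0} ∩
      {ω | pointCount (Ψ ω) (Metric.closedBall x ‖x‖) = 0}) =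
        ENNReal.ofReal (Real.exp (-(secrecyConst * lam * Real.pi * ‖x‖ ^ 2))) := by
    have h := hΨ.measure_pointCount_eq_zero ((hB 0).union (hB x))
      (by simp [volume_union_closedBall_norm])
    rw [volume_union_closedBall_norm, ENNReal.toReal_ofReal (by positivity)] at h
    rw [show secrecyConst * lam * Real.pi * ‖x‖ ^ 2 = lam * (secrecyConst * Real.pi * ‖x‖ ^ 2) by
      ring, ← h]
    congr 1
    ext ω
    simp only [Set.mem_inter_iff, Set.mem_ofPred_eq, pointCount_eq_zero_iff,
      Set.disjoint_union_right]
  have h := measure_union_add_inter (μ := P) {ω | pointCount (Ψ ω) (Metric.closedBall 0 ‖x‖) = 0}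
    (hΨ.measurable_count _ (hB x) (MeasurableSet.of_discrete (s := {0})))
  change P (_ ∪ {ω | pointCount (Ψ ω) (Metric.closedBall x ‖x‖) = 0}) +
    P (_ ∩ {ω | pointCount (Ψ ω) (Metric.closedBall x ‖x‖) = 0}) =
    _ + P {ω | pointCount (Ψ ω) (Metric.closedBall x ‖x‖) = 0} at h
  rw [hball, hball, hunion, ← ENNReal.ofReal_add (by positivity) (by positivity)] at h
  rw [two_mul, ENNReal.ofReal_sub _ (by positivity), ← ENNReal.eq_sub_of_add_eq (by simp) h]
  rfl

theorem integrableOn_closedBall_exp_neg_mul_norm_sq (a r : ℝ) :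
    IntegrableOn (fun x => Real.exp (-(a * ‖x‖ ^ 2)))
      (Metric.closedBall (0 : EuclideanSpace ℝ (Fin 2)) r) :=
  (Continuous.continuousOn (by fun_prop)).integrableOn_compact (isCompact_closedBall _ _)

/-- As `c ≥ 1`, the subtracted exponential is the smaller one; this keeps the integrand nonnegative,
so `ENNReal.ofReal` loses nothing. -/
theorem exp_neg_secrecyConst_mul_le (a : ℝ≥0) (x : EuclideanSpace ℝ (Fin 2)) :
    Real.exp (-(secrecyConst * a * Real.pi * ‖x‖ ^ 2)) ≤ Real.exp (-(a * Real.pi * ‖x‖ ^ 2)) := by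
  have hc : 1 ≤ secrecyConst := by
    have : 0 ≤ √3 / (2 * Real.pi) := by positivity
    unfold secrecyConst
    linarith
  refine Real.exp_le_exp.2 (neg_le_neg ?_)
  rw [mul_assoc secrecyConst, mul_assoc secrecyConst]
  exact le_mul_of_one_le_left (by positivity) hc

theorem setIntegral_void_or_void (hlam : 0 < lam) {r : ℝ} (hr : 0 ≤ r) :
    ∫ x in Metric.closedBall (0 : EuclideanSpace ℝ (Fin 2)) r,
      (2 * Real.exp (-(lam * Real.pi * ‖x‖ ^ 2)) -
        Real.exp (-(secrecyConst * lam * Real.pi * ‖x‖ ^ 2))) =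
      2 / lam * (1 - Real.exp (-(lam * Real.pi * r ^ 2))) -
        1 / (secrecyConst * lam) * (1 - Real.exp (-(secrecyConst * lam * Real.pi * r ^ 2))) := by
  have hc := secrecyConst_pos
  have hl : (0 : ℝ) < lam := hlam
  rw [integral_sub ((integrableOn_closedBall_exp_neg_mul_norm_sq _ r).const_mul 2)
    (integrableOn_closedBall_exp_neg_mul_norm_sq _ r), integral_const_mul,
    setIntegral_closedBall_exp_neg_mul_norm_sq (by positivity) hr,
    setIntegral_closedBall_exp_neg_mul_norm_sq (by positivity) hr]
  field_simp

theorem void_or_void_nonneg (a : ℝ≥0) (x : EuclideanSpace ℝ (Fin 2)) :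
    0 ≤ 2 * Real.exp (-(a * Real.pi * ‖x‖ ^ 2)) -
      Real.exp (-(secrecyConst * a * Real.pi * ‖x‖ ^ 2)) := by
  linarith [exp_neg_secrecyConst_mul_le a x, Real.exp_pos (-(a * Real.pi * ‖x‖ ^ 2))]

theorem lintegral_measure_void_or_void (hΨ : IsPoissonProcess P Ψ lam) (hlam : 0 < lam) {r : ℝ}
    (hr : 0 ≤ r) :
    ∫⁻ x in Metric.closedBall (0 : EuclideanSpace ℝ (Fin 2)) r,
      P {ω | pointCount (Ψ ω) (Metric.closedBall 0 ‖x‖) = 0 ∨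
        pointCount (Ψ ω) (Metric.closedBall x ‖x‖) = 0} =
      ENNReal.ofReal (2 / lam * (1 - Real.exp (-(lam * Real.pi * r ^ 2))) -
        1 / (secrecyConst * lam) * (1 - Real.exp (-(secrecyConst * lam * Real.pi * r ^ 2)))) := by
  simp_rw [hΨ.measure_void_or_void]
  rw [← setIntegral_void_or_void hlam hr]
  exact (ofReal_integral_eq_lintegral_ofReal
    (((integrableOn_closedBall_exp_neg_mul_norm_sq _ r).const_mul 2).sub
      (integrableOn_closedBall_exp_neg_mul_norm_sq _ r))
    (ae_of_all _ (void_or_void_nonneg lam))).symm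

end Probability

/-- The degree `N'` of the node at the origin is a random variable, is almost surely finite, has
finite expectation, and the expectation has the stated value. -/
theorem proposition3 {Ω : Type*} [MeasurableSpace Ω] (P : Measure Ω) [IsProbabilityMeasure P]
    (Φ Ψ : Ω → Set (EuclideanSpace ℝ (Fin 2))) (lam : ℝ≥0) (r : ℝ) (hlam : 0 < lam) (hr : 0 ≤ r)
    (hΦ : IsPoissonProcess P Φ 1) (hΨ : IsPoissonProcess P Ψ lam)
    (hind : IndepPointProcesses P Φ Ψ) :
    AEMeasurable (fun ω => enhancedDegree (Φ ω) (Ψ ω) r) P ∧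
    (∀ᵐ ω ∂P, enhancedDegree (Φ ω) (Ψ ω) r ≠ ⊤) ∧
    Integrable (fun ω => ((enhancedDegree (Φ ω) (Ψ ω) r).toNat : ℝ)) P ∧
    ∫ ω, ((enhancedDegree (Φ ω) (Ψ ω) r).toNat : ℝ) ∂P =
      2 / lam * (1 - Real.exp (-(lam * Real.pi * r ^ 2))) -
        1 / (secrecyConst * lam) * (1 - Real.exp (-(secrecyConst * lam * Real.pi * r ^ 2))) := by
  have hball (p : EuclideanSpace ℝ (Fin 2) × ℝ) : MeasurableSet (Metric.closedBall p.1 p.2) :=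
    Metric.isClosed_closedBall.measurableSet
  let A : Set ((EuclideanSpace ℝ (Fin 2) × ℝ → ℕ∞) × EuclideanSpace ℝ (Fin 2)) :=
    Prod.snd ⁻¹' {0}ᶜ ∩ (voidSet (fun _ => 0) (fun x => ‖x‖) ∪ voidSet id (fun x => ‖x‖))
  have hA : MeasurableSet A :=
    (measurable_snd (measurableSet_singleton 0).compl).inter
      ((measurableSet_voidSet continuous_const continuous_norm).union
        (measurableSet_voidSet continuous_id continuous_norm))
  have hY : Measurable fun ω => ballCounts (Ψ ω) :=
    measurable_pi_iff.2 fun p => hΨ.measurable_count _ (hball p)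
  obtain ⟨hmeas, hint⟩ := hΦ.lintegral_pointCount_of_indep hY
    (indep_of_indep_of_le_right hind (comap_ballCounts_le Ψ)) hA (isCompact_closedBall 0 r)
  have hmemA {ω : Ω} (hω : ∀ K, IsCompact K → (Ψ ω ∩ K).Finite) (x : EuclideanSpace ℝ (Fin 2)) :
      (ballCounts (Ψ ω), x) ∈ A ↔ x ≠ 0 ∧ (pointCount (Ψ ω) (Metric.closedBall 0 ‖x‖) = 0 ∨
        pointCount (Ψ ω) (Metric.closedBall x ‖x‖) = 0) := by
    exact and_congr Iff.rfl (or_congr (mem_voidSet_iff hω) (mem_voidSet_iff hω))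
  have hdeg : (fun ω => pointCount (Φ ω) ({x | (ballCounts (Ψ ω), x) ∈ A} ∩
      Metric.closedBall 0 r)) =ᵐ[P] fun ω => enhancedDegree (Φ ω) (Ψ ω) r := by
    filter_upwards [hΨ.locallyFinite] with ω hω
    simp only [enhancedDegree_eq_pointCount, hmemA hω]
  have hmeasN := hmeas.congr hdeg
  have hmeasE : AEMeasurable (fun ω => (enhancedDegree (Φ ω) (Ψ ω) r : ℝ≥0∞)) P :=
    (measurable_of_countable _).comp_aemeasurable hmeasN
  have hlint : ∫⁻ ω, (enhancedDegree (Φ ω) (Ψ ω) r : ℝ≥0∞) ∂P =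
      ENNReal.ofReal (2 / lam * (1 - Real.exp (-(lam * Real.pi * r ^ 2))) -
        1 / (secrecyConst * lam) *
          (1 - Real.exp (-(secrecyConst * lam * Real.pi * r ^ 2)))) := by
    rw [← lintegral_measure_void_or_void hΨ hlam hr,
      ← lintegral_congr_ae (hdeg.mono fun ω hω => congrArg ENat.toENNReal hω), hint,
      ENNReal.coe_one, one_mul]
    refine lintegral_congr_ae ?_
    -- The condition `x ≠ 0` in `A` costs nothing, since a point has zero area.
    filter_upwards [ae_restrict_of_ae (Measure.ae_ne volume 0)] with x hx
    refine measure_congr ?_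
    filter_upwards [hΨ.locallyFinite] with ω hω
    exact propext ((hmemA hω x).trans (and_iff_right hx))
  have hfin := ae_lt_top' hmeasE (by rw [hlint]; exact ENNReal.ofReal_ne_top)
  have htoReal : (fun ω => ((enhancedDegree (Φ ω) (Ψ ω) r).toNat : ℝ)) =ᵐ[P]
      fun ω => (enhancedDegree (Φ ω) (Ψ ω) r : ℝ≥0∞).toReal := by
    filter_upwards [hfin] with ω hω
    obtain ⟨n, hn⟩ := ENat.ne_top_iff_exists.1 (ENat.toENNReal_lt_top.1 hω).ne
    simp [← hn]
  refine ⟨hmeasN, hfin.mono fun ω hω => (ENat.toENNReal_lt_top.1 hω).ne, ?_, ?_⟩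
  · refine (integrable_congr htoReal).2 (integrable_toReal_of_lintegral_ne_top hmeasE ?_)
    rw [hlint]
    exact ENNReal.ofReal_ne_top
  · rw [integral_congr_ae htoReal, integral_toReal hmeasE hfin, hlint, ENNReal.toReal_ofReal]
    -- The closed form is nonnegative because it is the integral of a nonnegative function.
    rw [← setIntegral_void_or_void hlam hr]
    exact integral_nonneg (void_or_void_nonneg lam)
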